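/- Let $R$ be an integer with $|R|\ge 2$, let $B\subset\mathbb{Z}$ be a finite set with $0\in B$ and $N:=|B|$, and put $\tau_b(x)=R^{-1}(x+b)$ for $b\in B$, $x\in\mathbb{R}$. Let $\mu=\mu(R,B)$ be the unique Borel probability measure on $\mathbb{R}$ with $\mu(E)=\frac1N\sum_{b\in B}\mu(\tau_b^{-1}(E))$ for all Borel sets $E$, let $X_B=\{\sum_{k\ge1}R^{-k}b_k : b_k\in B\}$, and suppose that $\mu$ has no overlap, i.e. $\mu(\tau_b(X_B)\cap\tau_{b'}(X_B))=0$ for all $b\ne b'$ in $B$. Let $L\subset\mathbb{Z}$ be a finite set with $0\in L$ and let $(\alpha_l)_{l\in L}$ be nonzero complex numbers such that (i) $\alpha_0=1$; (ii) the matrix $T=\frac1{\sqrt N}\left(e^{2\pi i R^{-1}lb}\,\alpha_l\right)_{l\in L,\,b\in B}$ satisfies $T^*T=I_N$. For $k\in\mathbb{Z}$ let $[k]=\{k'\in\mathbb{Z} : (k'-k)R^{-1}b\in\mathbb{Z}\text{ for all } b\in B\}$. Assume that for every $l\in L$ with $l\ne0$, $$[l]\cap L\ne\{l'\in L : l'\equiv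 l\ (\mathrm{mod}\ R)\}.$$ Let $\Omega(L)$ be the set of finite words with letters in $L$ that are either empty or end in a nonzero letter, and let $e_\lambda(x)=e^{2\pi i\lambda x}$. Then the family $$\Big(\prod_{i=0}^k\alpha_{l_i}\Big)\,e_{l_0+Rl_1+\dots+R^kl_k},\qquad l_0\dots l_k\in\Omega(L),$$ indexed by the words in $\Omega(L)$ (the empty word contributes the constant function $\mathbf 1$), is a Parseval frame for $L^2(\mu)$: for every $v\in L^2(\mu)$, the sum over all words in $\Omega(L)$ of the squared moduli of the inner products of $v$ with the members of the family equals $\|v\|^2$. -/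

import Mathlib

noncomputable section

namespace WeightedFourier

open MeasureTheory Filter Topology
open scoped ENNReal

/-! ### The affine iterated function system and its invariant measure -/

/-- The affine contraction `τ_b(x) = R⁻¹ (x + b)` of the real line. -/
def ifsMap (R b : ℤ) (x : ℝ) : ℝ := (R : ℝ)⁻¹ * (x + (b : ℝ))

/-- The point `∑_{k ≥ 1} R^{-k} b_k` with digit sequence `b`. -/
def codingMap (R : ℤ) (B : Finset ℤ) (ω : ℕ → B) : ℝ :=
  ∑' k : ℕ, ((R : ℝ)⁻¹) ^ (k + 1) * ((ω k : ℤ) : ℝ)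

/-- The self-affine set `X_B = {∑_{k ≥ 1} R^{-k} b_k : b_k ∈ B}`. -/
def attractor (R : ℤ) (B : Finset ℤ) : Set ℝ := Set.range (codingMap R B)

/-- `μ` is a Borel probability measure on the line with
`μ(E) = (1/N) ∑_{b ∈ B} μ(τ_b⁻¹(E))` for all Borel sets `E`, where `N = |B|`. -/
structure IsSelfAffineMeasure (R : ℤ) (B : Finset ℤ) (μ : Measure ℝ) : Prop where
  isProbabilityMeasure : IsProbabilityMeasure μ
  invariant : ∀ E : Set ℝ, MeasurableSet E →
    μ E = (B.card : ℝ≥0∞)⁻¹ * ∑ b ∈ B, μ (ifsMap R b ⁻¹' E)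

lemma continuous_ifsMap (R b : ℤ) : Continuous (ifsMap R b) := by
  unfold ifsMap; fun_prop

lemma abs_inv_lt_one {R : ℤ} (hR : 2 ≤ |R|) : |(R : ℝ)⁻¹| < 1 := by
  have h : (2 : ℝ) ≤ |(R : ℝ)| := by exact_mod_cast hR
  rw [abs_inv]
  exact inv_lt_one_of_one_lt₀ (by linarith)

lemma exists_digit_bound (B : Finset ℤ) : ∃ C : ℝ, ∀ b ∈ B, |(b : ℝ)| ≤ C :=
  ⟨∑ b ∈ B, |(b : ℝ)|, fun _ hb =>
    Finset.single_le_sum (f := fun b : ℤ => |(b : ℝ)|) (fun _ _ => abs_nonneg _) hb⟩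

lemma coding_bound {R : ℤ} (hR : 2 ≤ |R|) (B : Finset ℤ) :
    ∃ u : ℕ → ℝ, Summable u ∧ ∀ (k : ℕ) (ω : ℕ → B),
      ‖((R : ℝ)⁻¹) ^ (k + 1) * ((ω k : ℤ) : ℝ)‖ ≤ u k := by
  obtain ⟨C, hC⟩ := exists_digit_bound B
  refine ⟨fun k => |(R : ℝ)⁻¹| ^ (k + 1) * C, ?_, fun k ω => ?_⟩
  · exact ((summable_nat_add_iff 1).2
      (summable_geometric_of_lt_one (abs_nonneg _) (abs_inv_lt_one hR))).mul_right C
  · rw [norm_mul, norm_pow, Real.norm_eq_abs, Real.norm_eq_abs]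
    exact mul_le_mul_of_nonneg_left (hC _ (ω k).2) (by positivity)

lemma summable_coding {R : ℤ} (hR : 2 ≤ |R|) (B : Finset ℤ) (ω : ℕ → B) :
    Summable fun k : ℕ => ((R : ℝ)⁻¹) ^ (k + 1) * ((ω k : ℤ) : ℝ) := by
  obtain ⟨u, hu, h⟩ := coding_bound hR B
  exact Summable.of_norm_bounded hu fun k => h k ω

lemma continuous_codingMap {R : ℤ} (hR : 2 ≤ |R|) (B : Finset ℤ) :
    Continuous (codingMap R B) := by
  obtain ⟨u, hu, h⟩ := coding_bound hR B
  refine continuous_tsum (fun k => ?_) hu h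
  have : Continuous fun b : B => ((b : ℤ) : ℝ) := continuous_of_discreteTopology
  exact continuous_const.mul (this.comp (continuous_apply k))

/-- Put the digit `b` in front of a digit sequence. -/
def consDigit {B : Finset ℤ} (b : B) (ω : ℕ → B) : ℕ → B
  | 0 => b
  | k + 1 => ω k

lemma measurable_consDigit {B : Finset ℤ} (b : B) : Measurable (consDigit b) := by
  refine measurable_pi_lambda _ fun k => ?_
  cases k with
  | zero => exact measurable_const
  | succ k => exact measurable_pi_apply k

lemma codingMap_consDigit {R : ℤ} (hR : 2 ≤ |R|) {B : Finset ℤ} (b : B) (ω : ℕ → B) :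
    codingMap R B (consDigit b ω) = ifsMap R b (codingMap R B ω) := by
  unfold codingMap ifsMap
  rw [(summable_coding hR B (consDigit b ω)).tsum_eq_zero_add, mul_add, ← tsum_mul_left]
  simp only [consDigit, zero_add, pow_one]
  rw [add_comm]
  congr 1
  refine tsum_congr fun k => ?_
  ring

/-- The attractor is compact. -/
theorem isCompact_attractor {R : ℤ} (hR : 2 ≤ |R|) (B : Finset ℤ) :
    IsCompact (attractor R B) :=
  isCompact_range (continuous_codingMap hR B)

/-- The attractor satisfies `X_B = ⋃_{b ∈ B} τ_b(X_B)`. -/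
theorem attractor_eq_iUnion {R : ℤ} (hR : 2 ≤ |R|) (B : Finset ℤ) :
    attractor R B = ⋃ b ∈ B, ifsMap R b '' attractor R B := by
  ext x
  simp only [attractor, Set.mem_iUnion, Set.mem_image, Set.mem_range, exists_prop]
  constructor
  · rintro ⟨ω, rfl⟩
    refine ⟨ω 0, (ω 0).2, _, ⟨fun k => ω (k + 1), rfl⟩, ?_⟩
    rw [← codingMap_consDigit hR]
    congr 1
    ext k
    cases k <;> rfl
  · rintro ⟨b, hb, _, ⟨ω, rfl⟩, rfl⟩
    exact ⟨consDigit ⟨b, hb⟩ ω, codingMap_consDigit hR ⟨b, hb⟩ ω⟩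

/-- The uniform distribution on the digit set. -/
def digitMeasure (B : Finset ℤ) : Measure B := (B.card : ℝ≥0∞)⁻¹ • Measure.count

lemma card_inv_mul_card {B : Finset ℤ} (hB : B.Nonempty) :
    (B.card : ℝ≥0∞)⁻¹ * (B.card : ℝ≥0∞) = 1 :=
  ENNReal.inv_mul_cancel (by simpa using hB.ne_empty) (ENNReal.natCast_ne_top _)

lemma isProbabilityMeasure_digitMeasure {B : Finset ℤ} (hB : B.Nonempty) :
    IsProbabilityMeasure (digitMeasure B) := by
  constructor
  simp only [digitMeasure, Measure.smul_apply, smul_eq_mul]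
  rw [Measure.count_univ]
  simpa using card_inv_mul_card hB

lemma digitMeasure_apply {B : Finset ℤ} (s : Set B) :
    digitMeasure B s = (B.card : ℝ≥0∞)⁻¹ * ∑ b : B, s.indicator 1 b := by
  simp only [digitMeasure, Measure.smul_apply, smul_eq_mul]
  rw [Measure.count_apply (Set.toFinite s).measurableSet, ← tsum_fintype (L := .unconditional _),
    ← tsum_subtype]
  simp

lemma sum_map_consDigit {B : Finset ℤ}
    [IsProbabilityMeasure (digitMeasure B)] :
    (B.card : ℝ≥0∞)⁻¹ • ∑ b : B, (Measure.infinitePi fun _ : ℕ => digitMeasure B).map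
      (consDigit b) = Measure.infinitePi fun _ : ℕ => digitMeasure B := by
  classical
  refine Measure.eq_infinitePi _ fun s t ht => ?_
  obtain ⟨n, hn⟩ : ∃ n, s ⊆ Finset.range (n + 1) := by
    refine ⟨s.sup id, fun i hi => ?_⟩
    simpa [Nat.lt_succ_iff] using Finset.le_sup (f := id) hi
  set t' : ℕ → Set B := fun i => if i ∈ s then t i else Set.univ with ht'
  have htm : ∀ i, MeasurableSet (t' i) := fun i => (Set.toFinite _).measurableSet
  have hpi : Set.pi (s : Set ℕ) t = Set.pi (Finset.range (n + 1) : Set ℕ) t' := by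
    ext ω
    simp only [Set.mem_pi, Finset.mem_coe, ht']
    constructor
    · intro h i _
      by_cases hi : i ∈ s
      · simpa [hi] using h i hi
      · simp [hi]
    · intro h i hi
      simpa [hi] using h i (hn hi)
  have hprod : ∏ i ∈ s, digitMeasure B (t i)
      = ∏ i ∈ Finset.range (n + 1), digitMeasure B (t' i) := by
    rw [← Finset.prod_subset hn (fun i _ hi => by simp [ht', hi])]
    exact Finset.prod_congr rfl fun i hi => by simp [ht', hi]
  rw [hpi, hprod, Finset.prod_range_succ', digitMeasure_apply]
  simp only [Measure.smul_apply, Measure.finsetSum_apply, smul_eq_mul]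
  have key : ∀ b : B, (Measure.infinitePi fun _ : ℕ => digitMeasure B).map (consDigit b)
      (Set.pi (Finset.range (n + 1) : Set ℕ) t')
      = (t' 0).indicator 1 b * ∏ i ∈ Finset.range n, digitMeasure B (t' (i + 1)) := by
    intro b
    rw [Measure.map_apply (measurable_consDigit b)
      (MeasurableSet.pi (Finset.countable_toSet _) fun i _ => htm i)]
    by_cases hb : b ∈ t' 0
    · have : consDigit b ⁻¹' Set.pi (Finset.range (n + 1) : Set ℕ) t'
          = Set.pi (Finset.range n : Set ℕ) (fun i => t' (i + 1)) := by
        ext ω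
        simp only [Set.mem_preimage, Set.mem_pi, Finset.mem_coe, Finset.mem_range]
        constructor
        · intro h i hi
          exact h (i + 1) (by omega)
        · intro h i hi
          cases i with
          | zero => exact hb
          | succ i => exact h i (by omega)
      rw [this, Measure.infinitePi_pi _ fun i _ => htm _]
      simp [hb]
    · have : consDigit b ⁻¹' Set.pi (Finset.range (n + 1) : Set ℕ) t' = ∅ := by
        ext ω
        simp only [Set.mem_preimage, Set.mem_pi, Finset.mem_coe, Finset.mem_range,
          Set.mem_empty_iff_false, iff_false]
        intro h
        exact hb (h 0 (by omega))
      rw [this]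
      simp [hb]
  simp only [key]
  rw [← Finset.sum_mul]
  ring

lemma exists_isSelfAffineMeasure {R : ℤ} {B : Finset ℤ} (hR : 2 ≤ |R|) (hB : B.Nonempty) :
    ∃ μ : Measure ℝ, IsSelfAffineMeasure R B μ := by
  have := isProbabilityMeasure_digitMeasure hB
  have hm := (continuous_codingMap hR B).measurable
  refine ⟨(Measure.infinitePi fun _ : ℕ => digitMeasure B).map (codingMap R B),
    Measure.isProbabilityMeasure_map hm.aemeasurable, fun E hE => ?_⟩
  rw [Measure.map_apply hm hE]
  conv_lhs => rw [← sum_map_consDigit]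
  simp only [Measure.smul_apply, Measure.finsetSum_apply, smul_eq_mul]
  congr 1
  rw [← Finset.sum_coe_sort B]
  refine Finset.sum_congr rfl fun b _ => ?_
  rw [Measure.map_apply (measurable_consDigit b) (hm hE),
    Measure.map_apply hm ((continuous_ifsMap R b).measurable hE)]
  congr 1
  ext ω
  simp [codingMap_consDigit hR]

lemma IsSelfAffineMeasure.eq_sum_map {R : ℤ} {B : Finset ℤ} {μ : Measure ℝ}
    (h : IsSelfAffineMeasure R B μ) :
    μ = (B.card : ℝ≥0∞)⁻¹ • ∑ b ∈ B, μ.map (ifsMap R b) := by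
  ext E hE
  rw [h.invariant E hE]
  simp only [Measure.smul_apply, Measure.finsetSum_apply, smul_eq_mul]
  congr 1
  exact Finset.sum_congr rfl fun b _ =>
    (Measure.map_apply (continuous_ifsMap R b).measurable hE).symm

lemma charFun_map_ifsMap (R b : ℤ) (μ : Measure ℝ) (t : ℝ) :
    charFun (μ.map (ifsMap R b)) t
      = Complex.exp (t * (R : ℝ)⁻¹ * b * Complex.I) * charFun μ (t * (R : ℝ)⁻¹) := by
  rw [charFun_apply_real, charFun_apply_real,
    integral_map (continuous_ifsMap R b).aemeasurable (by fun_prop), ← integral_const_mul]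
  congr 1
  ext x
  rw [← Complex.exp_add]
  congr 1
  simp only [ifsMap]
  push_cast
  ring

lemma IsSelfAffineMeasure.charFun_eq {R : ℤ} {B : Finset ℤ} {μ : Measure ℝ}
    (h : IsSelfAffineMeasure R B μ) (t : ℝ) :
    charFun μ t = ((B.card : ℂ)⁻¹ * ∑ b ∈ B, Complex.exp (t * (R : ℝ)⁻¹ * b * Complex.I))
      * charFun μ (t * (R : ℝ)⁻¹) := by
  have := h.isProbabilityMeasure
  conv_lhs => rw [h.eq_sum_map]
  rw [charFun_apply_real, integral_smul_measure, integral_finsetSum_measure]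
  · simp only [← charFun_apply_real, charFun_map_ifsMap]
    rw [← Finset.sum_mul, ENNReal.toReal_inv, ENNReal.toReal_natCast, Complex.real_smul,
      Complex.ofReal_inv, Complex.ofReal_natCast, mul_assoc]
  · intro b _
    have : IsProbabilityMeasure (μ.map (ifsMap R b)) :=
      Measure.isProbabilityMeasure_map (continuous_ifsMap R b).aemeasurable
    refine Integrable.of_bound (C := 1) (by fun_prop) (ae_of_all _ fun x => ?_)
    rw [← Complex.ofReal_mul, Complex.norm_exp_ofReal_mul_I]

/-- Existence and uniqueness of the self-affine measure. -/
theorem existsUnique_isSelfAffineMeasure {R : ℤ} {B : Finset ℤ} (hR : 2 ≤ |R|)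
    (hB : B.Nonempty) : ∃! μ : Measure ℝ, IsSelfAffineMeasure R B μ := by
  obtain ⟨μ, hμ⟩ := exists_isSelfAffineMeasure hR hB
  refine ⟨μ, hμ, fun ν hν => ?_⟩
  have := hμ.isProbabilityMeasure
  have := hν.isProbabilityMeasure
  refine Measure.ext_of_charFun (funext fun t => ?_)
  set D : ℝ → ℝ := fun t => ‖charFun ν t - charFun μ t‖ with hD
  have hcard : (0 : ℝ) < B.card := by exact_mod_cast hB.card_pos
  have hstep : ∀ t, D t ≤ D (t * (R : ℝ)⁻¹) := by
    intro t
    simp only [hD]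
    rw [hν.charFun_eq t, hμ.charFun_eq t, ← mul_sub, norm_mul]
    refine mul_le_of_le_one_left (norm_nonneg _) ?_
    rw [norm_mul, norm_inv, Complex.norm_natCast, inv_mul_le_iff₀ hcard, mul_one]
    refine (norm_sum_le _ _).trans ?_
    have : ∀ b ∈ B, ‖Complex.exp (t * (R : ℝ)⁻¹ * b * Complex.I)‖ = 1 := fun b _ => by
      have := Complex.norm_exp_ofReal_mul_I (t * (R : ℝ)⁻¹ * b)
      push_cast at this ⊢
      exact this
    rw [Finset.sum_congr rfl this]
    simp
  have hiter : ∀ n : ℕ, D t ≤ D (t * ((R : ℝ)⁻¹) ^ n) := by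
    intro n
    induction n with
    | zero => simp
    | succ n ih =>
      refine ih.trans ((hstep _).trans_eq ?_)
      rw [pow_succ, mul_assoc]
  have hcont : Continuous D := by
    have h1 : Continuous (charFun ν) := by fun_prop
    have h2 : Continuous (charFun μ) := by fun_prop
    exact (h1.sub h2).norm
  have hlim : Tendsto (fun n : ℕ => D (t * ((R : ℝ)⁻¹) ^ n)) atTop (𝓝 (D (t * 0))) :=
    (hcont.tendsto _).comp
      ((tendsto_pow_atTop_nhds_zero_of_abs_lt_one (abs_inv_lt_one hR)).const_mul t)
  have h0 : D (t * 0) = 0 := by simp [hD, charFun_zero]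
  have : D t ≤ 0 := by
    rw [← h0]
    exact ge_of_tendsto' hlim hiter
  exact sub_eq_zero.1 (norm_eq_zero.1 (le_antisymm this (norm_nonneg _)))

/-- The self-affine measure `μ(R, B)`: the unique measure that satisfies
`IsSelfAffineMeasure R B`. -/
def selfAffineMeasure (R : ℤ) (B : Finset ℤ) (hR : 2 ≤ |R|) (hB : B.Nonempty) : Measure ℝ :=
  (existsUnique_isSelfAffineMeasure hR hB).choose

theorem selfAffineMeasure_spec (R : ℤ) (B : Finset ℤ) (hR : 2 ≤ |R|) (hB : B.Nonempty) :
    IsSelfAffineMeasure R B (selfAffineMeasure R B hR hB) :=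
  (existsUnique_isSelfAffineMeasure hR hB).choose_spec.1

instance instIsProbabilityMeasureSelfAffineMeasure (R : ℤ) (B : Finset ℤ) (hR : 2 ≤ |R|) (hB : B.Nonempty) :
    IsProbabilityMeasure (selfAffineMeasure R B hR hB) :=
  (selfAffineMeasure_spec R B hR hB).isProbabilityMeasure

/-- The no overlap condition for `μ`: `μ(τ_b(X_B) ∩ τ_{b'}(X_B)) = 0` for all `b ≠ b'` in `B`. -/
def NoOverlap (R : ℤ) (B : Finset ℤ) (μ : Measure ℝ) : Prop :=
  ∀ b ∈ B, ∀ b' ∈ B, b ≠ b' →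
    μ (ifsMap R b '' attractor R B ∩ ifsMap R b' '' attractor R B) = 0

/-! ### The matrix of the weights and the congruence classes -/

/-- The matrix `(1/√N) (e^{2π i R⁻¹ l b} α_l)` with rows `l ∈ L` and columns `b ∈ B`. -/
def weightMatrix (R : ℤ) (B L : Finset ℤ) (α : ℤ → ℂ) : Matrix L B ℂ := fun l b =>
  ((Real.sqrt B.card : ℝ) : ℂ)⁻¹ *
    (Complex.exp (2 * Real.pi * Complex.I * ((R : ℂ)⁻¹ * (l : ℤ) * (b : ℤ))) * α l)

/-- The class `[k] = {k' ∈ ℤ : (k' - k) R⁻¹ b ∈ ℤ for all b ∈ B}`. -/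
def congClass (R : ℤ) (B : Finset ℤ) (k : ℤ) : Set ℤ :=
  {k' : ℤ | ∀ b ∈ B, ∃ n : ℤ, ((k' - k : ℤ) : ℝ) * ((R : ℝ)⁻¹ * (b : ℝ)) = (n : ℝ)}

/-! ### The weighted exponential family -/

/-- `Ω(L)`: the finite words with letters in `L` that are empty or have a nonzero last letter. -/
def Word (L : Finset ℤ) : Type :=
  {w : List ℤ // (∀ l ∈ w, l ∈ L) ∧ ∀ h : w ≠ [], w.getLast h ≠ 0}

/-- The frequency `l_0 + R l_1 + ⋯ + R^k l_k` of the word `l_0 l_1 ⋯ l_k`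
(it is `0` for the empty word). -/
def wordFrequency (R : ℤ) (w : List ℤ) : ℤ := ∑ i : Fin w.length, R ^ (i : ℕ) * w.get i

/-- The weight `∏ α_{l_i}` of the word `l_0 l_1 ⋯ l_k` (it is `1` for the empty word). -/
def wordWeight (α : ℤ → ℂ) (w : List ℤ) : ℂ := (w.map α).prod

/-- The exponential function `e_t(x) = e^{2π i t x}`. -/
def expFun (t x : ℝ) : ℂ := Complex.exp (2 * Real.pi * Complex.I * t * x)

lemma memLp_expFun (μ : Measure ℝ) [IsFiniteMeasure μ] (t : ℝ) : MemLp (expFun t) 2 μ := by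
  refine MemLp.of_bound (C := 1) ?_ (ae_of_all _ fun x => ?_)
  · unfold expFun
    fun_prop
  · have h : (2 * Real.pi * Complex.I * t * x : ℂ) = ((2 * Real.pi * t * x : ℝ) : ℂ) * Complex.I := by
      push_cast
      ring
    rw [expFun, h, Complex.norm_exp_ofReal_mul_I]

/-- The exponential function `e_t` as an element of `L²(μ)`. -/
def expLp (μ : Measure ℝ) [IsFiniteMeasure μ] (t : ℝ) : Lp ℂ 2 μ := (memLp_expFun μ t).toLp

/-- The family `(∏ α_{l_i}) e_{l_0 + R l_1 + ⋯ + R^k l_k}` in `L²(μ)`, indexed by the words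
`l_0 ⋯ l_k` in `Ω(L)`. -/
def weightedExpFamily (R : ℤ) (L : Finset ℤ) (α : ℤ → ℂ) (μ : Measure ℝ) [IsFiniteMeasure μ]
    (w : Word L) : Lp ℂ 2 μ :=
  wordWeight α w.1 • expLp μ (wordFrequency R w.1 : ℝ)

/-- A Parseval frame of a Hilbert space: `∑ |⟨v, e_i⟩|² = ‖v‖²` for all `v`, that is, a frame
with both frame bounds equal to `1`. -/
def IsParsevalFrame {ι H : Type*} [NormedAddCommGroup H] [InnerProductSpace ℂ H]
    (e : ι → H) : Prop :=
  ∀ v : H, HasSum (fun i => ‖(inner ℂ v (e i) : ℂ)‖ ^ 2) (‖v‖ ^ 2)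

end WeightedFourier

end

namespace WeightedFourier

open MeasureTheory Filter Topology
open scoped ENNReal ComplexConjugate BoundedContinuousFunction

/-! ### Consequences of self-affinity -/

/-! To each letter `l` belongs the operator `S_l v = conj α_l · (1/N) ∑_b conj (e_l ∘ τ_b) (v ∘
τ_b)`. Orthonormality of the columns of the weight matrix gives `∑_l ‖S_l v‖² = ‖v‖²`, and `⟨S_l v,
e_k⟩ = α_l ⟨v, e_{l + R k}⟩` for integers `k`, so applying `S_l` to `v` amounts to prefixing words
by `l`. Hence the frame sum `F` satisfies `F(v) = ∑_l F(S_l v)`; the same recursion on words of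
bounded length yields Bessel's inequality (`frameSum_le`), and the analysis operator is a
contraction.

It remains to show that this contraction is isometric, and by `norm_map_eq_of_total` it suffices to
test it on the exponentials. Let `H(t)` be the frame sum of `e_t`. Since `S_l e_t` is a multiple of
`e_{(t-l)/R}`, `H` is harmonic for a random walk: `H(t) = ∑_l p_l(t) H((t-l)/R)` with `∑_l p_l = 1`.
Moreover `H ≤ 1`, `H(0) = 1`, and `H` is real analytic because `μ` has bounded support.

If `H` were below `1` somewhere, its minimizers on a large interval would form a set that is finite
(by analyticity) and closed under steps of positive probability. Such a set contains `0`
(`zero_mem_of_finite_invariant`): in a minimal one all points are periodic, hence rational with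
denominator prime to `R`; a step by `l ≠ 0` would come with a second one by some `l'` in the class
of `l` with `l' ≢ l` mod `R`, and the difference of the two targets would be `(l' - l)/R` up to
sign, which is impossible. So only `x → x/R` occurs, and it tends to `0`. But `H(0) = 1` is not the
minimum, a contradiction. -/

lemma IsSelfAffineMeasure.map_le {R : ℤ} {B : Finset ℤ} {μ : Measure ℝ}
    (h : IsSelfAffineMeasure R B μ) {b : ℤ} (hb : b ∈ B) :
    μ.map (ifsMap R b) ≤ (B.card : ℝ≥0∞) • μ := by
  refine Measure.le_iff.2 fun E hE => ?_
  have h0 : (B.card : ℝ≥0∞) ≠ 0 := by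
    simpa using Finset.ne_empty_of_mem hb
  rw [Measure.map_apply (continuous_ifsMap R b).measurable hE, Measure.smul_apply, smul_eq_mul,
    h.invariant E hE, ← mul_assoc, ENNReal.mul_inv_cancel h0 (ENNReal.natCast_ne_top _), one_mul]
  exact Finset.single_le_sum (f := fun b => μ (ifsMap R b ⁻¹' E)) (fun _ _ => zero_le) hb

lemma IsSelfAffineMeasure.quasiMeasurePreserving {R : ℤ} {B : Finset ℤ} {μ : Measure ℝ}
    (h : IsSelfAffineMeasure R B μ) {b : ℤ} (hb : b ∈ B) :
    Measure.QuasiMeasurePreserving (ifsMap R b) μ μ :=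
  ⟨(continuous_ifsMap R b).measurable,
    (Measure.absolutelyContinuous_of_le (h.map_le hb)).trans
      Measure.smul_absolutelyContinuous⟩

lemma IsSelfAffineMeasure.memLp_comp {R : ℤ} {B : Finset ℤ} {μ : Measure ℝ}
    (h : IsSelfAffineMeasure R B μ) {b : ℤ} (hb : b ∈ B) {E : Type*} [NormedAddCommGroup E]
    {p : ℝ≥0∞} {f : ℝ → E} (hf : MemLp f p μ) : MemLp (fun x => f (ifsMap R b x)) p μ :=
  (hf.of_measure_le_smul (ENNReal.natCast_ne_top _) (h.map_le hb)).comp_of_map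
    (continuous_ifsMap R b).aemeasurable

lemma IsSelfAffineMeasure.integral_eq {R : ℤ} {B : Finset ℤ} {μ : Measure ℝ}
    (h : IsSelfAffineMeasure R B μ) {E : Type*} [NormedAddCommGroup E] [NormedSpace ℝ E]
    {f : ℝ → E} (hf : Integrable f μ) :
    ∫ x, f x ∂μ = (B.card : ℝ)⁻¹ • ∑ b ∈ B, ∫ x, f (ifsMap R b x) ∂μ := by
  have hmap : ∀ b ∈ B, Integrable f (μ.map (ifsMap R b)) := fun b hb =>
    hf.of_measure_le_smul (ENNReal.natCast_ne_top _) (h.map_le hb)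
  conv_lhs => rw [h.eq_sum_map]
  rw [integral_smul_measure, integral_finsetSum_measure hmap, ENNReal.toReal_inv,
    ENNReal.toReal_natCast]
  congr 1
  exact Finset.sum_congr rfl fun b hb =>
    integral_map (continuous_ifsMap R b).aemeasurable (hmap b hb).aestronglyMeasurable

/-- A self-affine measure has bounded support. -/
lemma IsSelfAffineMeasure.exists_ae_abs_le {R : ℤ} {B : Finset ℤ} {μ : Measure ℝ}
    (h : IsSelfAffineMeasure R B μ) (hR : 2 ≤ |R|) : ∃ C : ℝ, 0 ≤ C ∧ ∀ᵐ x ∂μ, |x| ≤ C := by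
  have := h.isProbabilityMeasure
  obtain ⟨C, hC⟩ := exists_digit_bound B
  have hR' : (2 : ℝ) ≤ |(R : ℝ)| := by exact_mod_cast hR
  set s : ℝ → Set ℝ := fun r => {x | |C| + r < |x|} with hs
  have hsm : ∀ r, MeasurableSet (s r) := fun r =>
    measurableSet_lt measurable_const measurable_id.abs
  -- If `|τ_b x| > |C| + r`, then `|x + b| > 2(|C| + r)` because `|R| ≥ 2`, and removing `b` costs
  -- at most `|C|`. The mass outside a ball is therefore bounded by the mass ever farther out, which
  -- tends to `0`.
  have hstep : ∀ r, 0 ≤ r → μ (s r) ≤ μ (s (2 * r)) := by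
    intro r hr
    rw [h.invariant _ (hsm r)]
    calc (B.card : ℝ≥0∞)⁻¹ * ∑ b ∈ B, μ (ifsMap R b ⁻¹' s r)
        ≤ (B.card : ℝ≥0∞)⁻¹ * ∑ _b ∈ B, μ (s (2 * r)) := by
          gcongr with b hb
          intro x hx
          have hx' : |C| + r < |(R : ℝ)⁻¹ * (x + b)| := hx
          rw [abs_mul, abs_inv, inv_mul_eq_div, lt_div_iff₀ (by linarith)] at hx'
          have h1 : |x + b| ≤ |x| + |C| :=
            (abs_add_le _ _).trans (by linarith [hC b hb, le_abs_self C])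
          have h2 : (|C| + r) * 2 ≤ (|C| + r) * |(R : ℝ)| := by
            have := abs_nonneg C
            gcongr
          show |C| + 2 * r < |x|
          linarith
      _ ≤ μ (s (2 * r)) := by
          rw [Finset.sum_const, nsmul_eq_mul, ← mul_assoc]
          exact mul_le_of_le_one_left' (ENNReal.inv_mul_le_one _)
  have hiter : ∀ n : ℕ, μ (s 1) ≤ μ (s (2 ^ n)) := by
    intro n
    induction n with
    | zero => simp
    | succ n ih =>
      rw [pow_succ']
      exact ih.trans (hstep _ (by positivity))
  have hlim : Tendsto (fun n : ℕ => μ (s (2 ^ n))) atTop (𝓝 (μ (⋂ n : ℕ, s (2 ^ n)))) := by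
    refine tendsto_measure_iInter_atTop (fun n => (hsm _).nullMeasurableSet) ?_
      ⟨0, measure_ne_top _ _⟩
    intro m n hmn x hx
    have hx' : |C| + 2 ^ n < |x| := hx
    have : (2 : ℝ) ^ m ≤ 2 ^ n := pow_le_pow_right₀ (by norm_num) hmn
    show |C| + 2 ^ m < |x|
    linarith
  have hempty : ⋂ n : ℕ, s (2 ^ n) = ∅ := by
    refine Set.eq_empty_of_forall_notMem fun x hx => ?_
    obtain ⟨n, hn⟩ := pow_unbounded_of_one_lt |x| (one_lt_two (α := ℝ))
    have hx' : |C| + 2 ^ n < |x| := Set.mem_iInter.1 hx n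
    linarith [abs_nonneg C]
  rw [hempty, measure_empty] at hlim
  have h0 : μ (s 1) = 0 := le_antisymm (ge_of_tendsto' hlim hiter) zero_le
  refine ⟨|C| + 1, by positivity, ?_⟩
  rw [ae_iff]
  simpa [hs] using h0

/-! ### Exponentials -/

lemma expFun_eq (t x : ℝ) : expFun t x = Complex.exp ((2 * Real.pi * t * x : ℝ) * Complex.I) := by
  rw [expFun]
  congr 1
  push_cast
  ring

lemma norm_expFun (t x : ℝ) : ‖expFun t x‖ = 1 := by
  rw [expFun_eq, Complex.norm_exp_ofReal_mul_I]

lemma conj_expFun (t x : ℝ) : conj (expFun t x) = expFun (-t) x := by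
  rw [expFun_eq, expFun_eq, ← Complex.exp_conj, map_mul, Complex.conj_ofReal, Complex.conj_I]
  congr 1
  push_cast
  ring

lemma expFun_add (s t x : ℝ) : expFun (s + t) x = expFun s x * expFun t x := by
  rw [expFun, expFun, expFun, ← Complex.exp_add]
  congr 1
  push_cast
  ring

lemma expFun_add_right (t x y : ℝ) : expFun t (x + y) = expFun t x * expFun t y := by
  rw [expFun, expFun, expFun, ← Complex.exp_add]
  congr 1
  push_cast
  ring

lemma expFun_eq_one {t x : ℝ} (n : ℤ) (h : t * x = n) : expFun t x = 1 := by
  rw [expFun, Complex.exp_eq_one_iff]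
  refine ⟨n, ?_⟩
  have : (t : ℂ) * x = n := by exact_mod_cast h
  rw [mul_assoc, this]
  ring

lemma continuous_expFun (t : ℝ) : Continuous (expFun t) := by
  unfold expFun
  fun_prop

lemma expFun_ifsMap (R b : ℤ) (t x : ℝ) :
    expFun t (ifsMap R b x) = expFun (t * (R : ℝ)⁻¹) x * expFun (t * (R : ℝ)⁻¹) b := by
  rw [← expFun_add_right, ifsMap, expFun, expFun]
  congr 1
  push_cast
  ring

/-- The translation by `b` is invisible to an integer frequency. This is what lets `e_{l + R k} ∘
τ_b` factor into a part depending on `b` and the common factor `e_k`. -/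
lemma expFun_mul_ifsMap {R : ℤ} (hR : R ≠ 0) (b k : ℤ) (x : ℝ) :
    expFun (R * k) (ifsMap R b x) = expFun k x := by
  have hR' : (R : ℝ) ≠ 0 := by exact_mod_cast hR
  rw [expFun_ifsMap, mul_right_comm, mul_inv_cancel₀ hR', one_mul,
    expFun_eq_one (t := k) (x := b) (k * b) (by push_cast; ring), mul_one]

/-- The normalized exponential sum `(1/N) ∑_{b ∈ B} e^{2π i t b}`. -/
noncomputable def digitSum (B : Finset ℤ) (t : ℝ) : ℂ := (B.card : ℂ)⁻¹ * ∑ b : B, expFun t (b : ℤ)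

lemma norm_expLp (μ : Measure ℝ) [IsProbabilityMeasure μ] (t : ℝ) : ‖expLp μ t‖ = 1 := by
  rw [expLp, Lp.norm_toLp, eLpNorm_congr_norm_ae (g := fun _ => (1 : ℂ))
    (ae_of_all _ fun x => by simp [norm_expFun])]
  rw [eLpNorm_const _ (by simp) (IsProbabilityMeasure.ne_zero μ)]
  simp

/-! ### The operators attached to the letters -/

lemma star_dotProduct_self {k : Type*} [Fintype k] (u : k → ℂ) :
    dotProduct (star u) u = ((∑ i, ‖u i‖ ^ 2 : ℝ) : ℂ) := by
  simp only [dotProduct, Pi.star_apply, RCLike.star_def]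
  push_cast
  exact Finset.sum_congr rfl fun i _ => Complex.conj_mul' (u i)

lemma sum_norm_sq_mulVec_of_isometry {m n : Type*} [Fintype m] [Fintype n] [DecidableEq n]
    {T : Matrix m n ℂ} (hT : T.conjTranspose * T = 1) (w : n → ℂ) :
    ∑ i, ‖T.mulVec w i‖ ^ 2 = ∑ j, ‖w j‖ ^ 2 := by
  have h : dotProduct (star (T.mulVec w)) (T.mulVec w) = dotProduct (star w) w := by
    rw [Matrix.star_mulVec, ← Matrix.dotProduct_mulVec, Matrix.mulVec_mulVec, hT,
      Matrix.one_mulVec]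
  rw [star_dotProduct_self, star_dotProduct_self] at h
  exact_mod_cast h

/-- The function `conj α_l (1/N) ∑_{b ∈ B} conj (e_l (τ_b x)) v(τ_b x)`. -/
noncomputable def letterFun (R : ℤ) (B : Finset ℤ) (α : ℤ → ℂ) (l : ℤ) (v : ℝ → ℂ) (x : ℝ) : ℂ :=
  conj (α l) * ((B.card : ℂ)⁻¹ * ∑ b : B, expFun (-l) (ifsMap R b x) * v (ifsMap R b x))

lemma memLp_expFun_mul {μ : Measure ℝ} (t : ℝ) {p : ℝ≥0∞} {v : ℝ → ℂ} (hv : MemLp v p μ) :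
    MemLp (fun x => expFun t x * v x) p μ := by
  refine hv.of_le ((continuous_expFun t).aestronglyMeasurable.mul hv.1) (ae_of_all _ fun x => ?_)
  rw [norm_mul, norm_expFun, one_mul]

lemma memLp_letterFun {R : ℤ} {B : Finset ℤ} {μ : Measure ℝ} (h : IsSelfAffineMeasure R B μ)
    (α : ℤ → ℂ) (l : ℤ) {v : ℝ → ℂ} (hv : MemLp v 2 μ) : MemLp (letterFun R B α l v) 2 μ := by
  have h1 : MemLp (fun x => expFun (-l) x * v x) 2 μ := memLp_expFun_mul _ hv
  have h2 : ∀ b ∈ (Finset.univ : Finset B),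
      MemLp (fun x => expFun (-l) (ifsMap R b x) * v (ifsMap R b x)) 2 μ :=
    fun b _ => h.memLp_comp (f := fun x => expFun (-l) x * v x) b.2 h1
  exact ((memLp_finsetSum _ h2).const_mul _).const_mul _

lemma letterFun_congr {R : ℤ} {B : Finset ℤ} {μ : Measure ℝ} (h : IsSelfAffineMeasure R B μ)
    (α : ℤ → ℂ) (l : ℤ) {u v : ℝ → ℂ} (huv : u =ᵐ[μ] v) :
    letterFun R B α l u =ᵐ[μ] letterFun R B α l v := by
  have : ∀ b : B, ∀ᵐ x ∂μ, u (ifsMap R b x) = v (ifsMap R b x) := fun b =>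
    (h.quasiMeasurePreserving b.2).ae_eq_comp huv
  filter_upwards [ae_all_iff.2 this] with x hx
  simp only [letterFun, hx]

/-- At a fixed `x`, the conjugates of the values for `l ∈ L` are, up to unimodular factors and
`N^{-1/2}`, the coordinates of the weight matrix applied to the vector `conj (v(τ_b x))`; that
matrix is an isometry. -/
lemma sum_norm_sq_letterFun {R : ℤ} {B : Finset ℤ} {L : Finset ℤ} {α : ℤ → ℂ}
    (hB : B.Nonempty) (hT : (weightMatrix R B L α).conjTranspose * weightMatrix R B L α = 1)
    (v : ℝ → ℂ) (x : ℝ) :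
    ∑ l : L, ‖letterFun R B α l v x‖ ^ 2
      = (B.card : ℝ)⁻¹ * ∑ b : B, ‖v (ifsMap R b x)‖ ^ 2 := by
  set w : B → ℂ := fun b => conj (v (ifsMap R b x)) with hw
  have hN : (0 : ℝ) < B.card := by exact_mod_cast hB.card_pos
  have hs : Real.sqrt B.card * Real.sqrt B.card = B.card := Real.mul_self_sqrt hN.le
  have key : ∀ l : L, conj (letterFun R B α l v x) = expFun ((l : ℤ) * (R : ℝ)⁻¹) x *
      ((Real.sqrt B.card : ℂ)⁻¹ * (weightMatrix R B L α).mulVec w l) := by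
    intro l
    have hs' : (B.card : ℂ)⁻¹ = (Real.sqrt B.card : ℂ)⁻¹ * (Real.sqrt B.card : ℂ)⁻¹ := by
      rw [← mul_inv, ← Complex.ofReal_mul, hs, Complex.ofReal_natCast]
    simp only [letterFun, Matrix.mulVec, dotProduct, weightMatrix, map_mul, map_sum, map_inv₀,
      Complex.conj_conj, Complex.conj_ofReal, conj_expFun, neg_neg, hs', Finset.mul_sum]
    refine Finset.sum_congr rfl fun b _ => ?_
    have he : Complex.exp (2 * Real.pi * Complex.I * ((R : ℂ)⁻¹ * (l : ℤ) * (b : ℤ)))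
        = expFun ((l : ℤ) * (R : ℝ)⁻¹) (b : ℤ) := by
      rw [expFun]
      congr 1
      push_cast
      ring
    rw [he, expFun_ifsMap]
    simp only [hw]
    ring
  have hnorm : ∀ l : L, ‖letterFun R B α l v x‖ ^ 2
      = (B.card : ℝ)⁻¹ * ‖(weightMatrix R B L α).mulVec w l‖ ^ 2 := by
    intro l
    rw [← RCLike.norm_conj (letterFun R B α l v x), key, norm_mul, norm_expFun, one_mul, norm_mul,
      mul_pow, norm_inv, Complex.norm_real, Real.norm_eq_abs, abs_of_nonneg (Real.sqrt_nonneg _),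
      inv_pow, Real.sq_sqrt hN.le]
  rw [Finset.sum_congr rfl fun l _ => hnorm l, ← Finset.mul_sum, sum_norm_sq_mulVec_of_isometry hT]
  simp [hw]

lemma letterFun_expFun (R : ℤ) (B : Finset ℤ) (α : ℤ → ℂ) (l : ℤ) (t : ℝ) (x : ℝ) :
    letterFun R B α l (expFun t) x
      = conj (α l) * digitSum B ((t - l) * (R : ℝ)⁻¹) * expFun ((t - l) * (R : ℝ)⁻¹) x := by
  rw [letterFun, digitSum, mul_assoc, mul_assoc, Finset.sum_mul]
  congr 2
  refine Finset.sum_congr rfl fun b _ => ?_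
  rw [← expFun_add, neg_add_eq_sub, expFun_ifsMap, mul_comm]

/-- The adjoint relation behind the word recursion: expand the right-hand integral by self-affinity
of `μ` and use that `e_{R k} ∘ τ_b = e_k`. -/
lemma integral_conj_letterFun_mul_expFun {R : ℤ} (hR : R ≠ 0) {B : Finset ℤ}
    {μ : Measure ℝ}
    (h : IsSelfAffineMeasure R B μ) (α : ℤ → ℂ) (l k : ℤ) {v : ℝ → ℂ} (hv : MemLp v 2 μ) :
    ∫ x, expFun k x * conj (letterFun R B α l v x) ∂μ
      = α l * ∫ x, expFun ((l + R * k : ℤ) : ℝ) x * conj (v x) ∂μ := by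
  have := h.isProbabilityMeasure
  have hint : Integrable (fun x => expFun ((l + R * k : ℤ) : ℝ) x * conj (v x)) μ :=
    (memLp_expFun_mul _ hv.star).integrable (by norm_num)
  rw [h.integral_eq hint, ← integral_finsetSum, ← integral_smul, ← integral_const_mul]
  · congr 1
    ext x
    rw [letterFun, ← Finset.sum_coe_sort B, Complex.real_smul]
    simp only [map_mul, map_sum, map_inv₀, Complex.conj_conj, map_natCast, conj_expFun, neg_neg,
      Finset.mul_sum]
    refine Finset.sum_congr rfl fun b _ => ?_
    rw [Int.cast_add, expFun_add, Int.cast_mul, expFun_mul_ifsMap hR]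
    push_cast
    ring
  · exact fun b hb => (h.memLp_comp hb (memLp_one_iff_integrable.2 hint)).integrable le_rfl

/-- The operator `v ↦ conj α_l (1/N) ∑_{b ∈ B} conj (e_l ∘ τ_b) (v ∘ τ_b)` on `L²(μ)`. -/
noncomputable def letterOp {R : ℤ} {B : Finset ℤ} {μ : Measure ℝ} (h : IsSelfAffineMeasure R B μ)
    (α : ℤ → ℂ) (l : ℤ) (v : Lp ℂ 2 μ) : Lp ℂ 2 μ :=
  (memLp_letterFun h α l (Lp.memLp v)).toLp

lemma Lp_two_norm_sq {μ : Measure ℝ} (v : Lp ℂ 2 μ) : ‖v‖ ^ 2 = ∫ x, ‖v x‖ ^ 2 ∂μ := by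
  have h := L2.inner_def (𝕜 := ℂ) v v
  rw [inner_self_eq_norm_sq_to_K] at h
  simp only [inner_self_eq_norm_sq_to_K] at h
  have h' : ((‖v‖ ^ 2 : ℝ) : ℂ) = ((∫ x, ‖v x‖ ^ 2 ∂μ : ℝ) : ℂ) := by
    rw [← integral_complex_ofReal]
    push_cast
    exact h
  exact_mod_cast h'

lemma sum_norm_sq_letterOp {R : ℤ} {B : Finset ℤ} {L : Finset ℤ} {α : ℤ → ℂ} {μ : Measure ℝ}
    (hB : B.Nonempty) (h : IsSelfAffineMeasure R B μ)
    (hT : (weightMatrix R B L α).conjTranspose * weightMatrix R B L α = 1) (v : Lp ℂ 2 μ) :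
    ∑ l : L, ‖letterOp h α l v‖ ^ 2 = ‖v‖ ^ 2 := by
  have hI : ∀ {u : ℝ → ℂ}, MemLp u 2 μ → Integrable (fun x => ‖u x‖ ^ 2) μ := fun hu =>
    (memLp_two_iff_integrable_sq_norm hu.1).1 hu
  have h1 : ∀ l : L, ‖letterOp h α l v‖ ^ 2 = ∫ x, ‖letterFun R B α l v x‖ ^ 2 ∂μ := by
    intro l
    rw [Lp_two_norm_sq]
    refine integral_congr_ae ?_
    filter_upwards [(memLp_letterFun h α l (Lp.memLp v)).coeFn_toLp] with x hx
    rw [letterOp, hx]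
  rw [Finset.sum_congr rfl fun l _ => h1 l,
    ← integral_finsetSum (f := fun (l : L) x => ‖letterFun R B α l v x‖ ^ 2) _
      fun l _ => hI (memLp_letterFun h α l (Lp.memLp v)),
    Lp_two_norm_sq, h.integral_eq (hI (Lp.memLp v))]
  simp only [sum_norm_sq_letterFun hB hT]
  rw [integral_const_mul, integral_finsetSum _ fun b _ => hI (h.memLp_comp b.2 (Lp.memLp v)),
    Finset.sum_coe_sort B (fun b => ∫ x, ‖v (ifsMap R b x)‖ ^ 2 ∂μ), smul_eq_mul]

lemma letterOp_expLp {R : ℤ} {B : Finset ℤ} {μ : Measure ℝ} [IsFiniteMeasure μ]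
    (h : IsSelfAffineMeasure R B μ) (α : ℤ → ℂ) (l : ℤ) (t : ℝ) :
    letterOp h α l (expLp μ t)
      = (conj (α l) * digitSum B ((t - l) * (R : ℝ)⁻¹)) • expLp μ ((t - l) * (R : ℝ)⁻¹) := by
  refine Lp.ext ?_
  have h1 : letterFun R B α l (expLp μ t) =ᵐ[μ] letterFun R B α l (expFun t) :=
    letterFun_congr h α l (memLp_expFun μ t).coeFn_toLp
  have h2 := (memLp_letterFun h α l (Lp.memLp (expLp μ t))).coeFn_toLp
  have h3 := Lp.coeFn_smul (conj (α l) * digitSum B ((t - l) * (R : ℝ)⁻¹))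
    (expLp μ ((t - l) * (R : ℝ)⁻¹))
  have h4 : expLp μ ((t - l) * (R : ℝ)⁻¹) =ᵐ[μ] _ := (memLp_expFun μ _).coeFn_toLp
  filter_upwards [h1, h2, h3, h4] with x h1 h2 h3 h4
  rw [h3, letterOp, h2, h1, letterFun_expFun, Pi.smul_apply, h4, smul_eq_mul]

lemma inner_expLp_right {μ : Measure ℝ} [IsFiniteMeasure μ] (v : Lp ℂ 2 μ) (t : ℝ) :
    inner ℂ v (expLp μ t) = ∫ x, expFun t x * conj (v x) ∂μ := by
  rw [L2.inner_def]
  refine integral_congr_ae ?_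
  have h4 : expLp μ t =ᵐ[μ] _ := (memLp_expFun μ _).coeFn_toLp
  filter_upwards [h4] with x hx
  rw [hx, RCLike.inner_apply]

lemma inner_letterOp_expLp {R : ℤ} (hR : R ≠ 0) {B : Finset ℤ}
    {μ : Measure ℝ} [IsFiniteMeasure μ]
    (h : IsSelfAffineMeasure R B μ) (α : ℤ → ℂ) (l k : ℤ) (v : Lp ℂ 2 μ) :
    inner ℂ (letterOp h α l v) (expLp μ k)
      = α l * inner ℂ v (expLp μ ((l + R * k : ℤ) : ℝ)) := by
  rw [inner_expLp_right, inner_expLp_right,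
    ← integral_conj_letterFun_mul_expFun hR h α l k (Lp.memLp v)]
  refine integral_congr_ae ?_
  filter_upwards [(memLp_letterFun h α l (Lp.memLp v)).coeFn_toLp] with x hx
  rw [letterOp, hx]

/-! ### Words and the Bessel inequality -/

lemma wordFrequency_nil (R : ℤ) : wordFrequency R [] = 0 := by
  simp [wordFrequency]

lemma wordFrequency_cons (R l : ℤ) (w : List ℤ) :
    wordFrequency R (l :: w) = l + R * wordFrequency R w := by
  simp only [wordFrequency, Finset.mul_sum, List.length_cons]
  rw [Fin.sum_univ_succ]
  simp [pow_succ', mul_assoc]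

lemma wordWeight_cons (α : ℤ → ℂ) (l : ℤ) (w : List ℤ) :
    wordWeight α (l :: w) = α l * wordWeight α w := by
  simp [wordWeight]

/-- The empty word. -/
def emptyWord (L : Finset ℤ) : Word L := ⟨[], by simp, by simp⟩

/-- Put a letter in front of a word; the letter `0` leaves the empty word unchanged. -/
def wordCons {L : Finset ℤ} (p : L × Word L) : Word L :=
  if h : (p.1 : ℤ) = 0 ∧ p.2.1 = [] then emptyWord L
  else ⟨(p.1 : ℤ) :: p.2.1, by
    refine ⟨fun l hl => ?_, fun _ => ?_⟩
    · rcases List.mem_cons.1 hl with rfl | hl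
      · exact p.1.2
      · exact p.2.2.1 l hl
    · by_cases hw : p.2.1 = []
      · simpa [hw] using h
      · rw [List.getLast_cons hw]
        exact p.2.2.2 hw⟩

lemma wordCons_of_trivial {L : Finset ℤ} {p : L × Word L} (h : (p.1 : ℤ) = 0 ∧ p.2.1 = []) :
    (wordCons p).1 = [] := by
  exact congrArg Subtype.val (dif_pos h)

lemma wordCons_of_not_trivial {L : Finset ℤ} {p : L × Word L}
    (h : ¬((p.1 : ℤ) = 0 ∧ p.2.1 = [])) : (wordCons p).1 = (p.1 : ℤ) :: p.2.1 := by
  exact congrArg Subtype.val (dif_neg h)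

/-- A nonempty word splits uniquely into head and tail, and the empty word comes only from the pair
of `0` and the empty word. The frame sum can thus be reindexed by first letters. -/
lemma bijective_wordCons {L : Finset ℤ} (hL : (0 : ℤ) ∈ L) :
    Function.Bijective (wordCons (L := L)) := by
  constructor
  · rintro ⟨l, w⟩ ⟨l', w'⟩ h
    have h' := congrArg Subtype.val h
    by_cases h1 : (l : ℤ) = 0 ∧ w.1 = [] <;> by_cases h2 : (l' : ℤ) = 0 ∧ w'.1 = []
    · exact Prod.ext (Subtype.ext (h1.1.trans h2.1.symm)) (Subtype.ext (h1.2.trans h2.2.symm))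
    · rw [wordCons_of_trivial h1, wordCons_of_not_trivial h2] at h'
      simp at h'
    · rw [wordCons_of_not_trivial h1, wordCons_of_trivial h2] at h'
      simp at h'
    · rw [wordCons_of_not_trivial h1, wordCons_of_not_trivial h2] at h'
      simp only [List.cons.injEq] at h'
      exact Prod.ext (Subtype.ext h'.1) (Subtype.ext h'.2)
  · rintro ⟨w, hw1, hw2⟩
    cases w with
    | nil =>
      refine ⟨(⟨0, hL⟩, emptyWord L), Subtype.ext ?_⟩
      exact wordCons_of_trivial ⟨rfl, rfl⟩
    | cons l w =>
      refine ⟨(⟨l, hw1 l (by simp)⟩, ⟨w, fun k hk => hw1 k (by simp [hk]), fun hw => ?_⟩),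
        Subtype.ext ?_⟩
      · have := hw2 (by simp)
        rwa [List.getLast_cons hw] at this
      · refine wordCons_of_not_trivial ?_
        rintro ⟨h1, h2⟩
        have h1' : l = 0 := h1
        have h2' : w = [] := h2
        subst h1' h2'
        exact hw2 (by simp) rfl

lemma length_wordCons_le {L : Finset ℤ} (p : L × Word L) (n : ℕ) :
    (wordCons p).1.length ≤ n + 1 ↔ p.2.1.length ≤ n := by
  by_cases h : (p.1 : ℤ) = 0 ∧ p.2.1 = []
  · rw [wordCons_of_trivial h, h.2]
    simp
  · rw [wordCons_of_not_trivial h]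
    simp

/-- In the collapsed case nothing is lost: the one-letter word `0` has weight `α 0 = 1` and
frequency `0`, as the empty word does. -/
lemma inner_weightedExpFamily_wordCons {R : ℤ} (hR : R ≠ 0) {B L : Finset ℤ} {μ : Measure ℝ}
    [IsFiniteMeasure μ] (h : IsSelfAffineMeasure R B μ) {α : ℤ → ℂ} (hα0 : α 0 = 1)
    (v : Lp ℂ 2 μ) (p : L × Word L) :
    inner ℂ v (weightedExpFamily R L α μ (wordCons p))
      = inner ℂ (letterOp h α p.1 v) (weightedExpFamily R L α μ p.2) := by
  have key : inner ℂ (letterOp h α p.1 v) (weightedExpFamily R L α μ p.2)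
      = wordWeight α ((p.1 : ℤ) :: p.2.1) *
        inner ℂ v (expLp μ (wordFrequency R ((p.1 : ℤ) :: p.2.1) : ℝ)) := by
    rw [weightedExpFamily, inner_smul_right, inner_letterOp_expLp hR h, wordWeight_cons,
      wordFrequency_cons]
    ring
  rw [key, weightedExpFamily, inner_smul_right]
  by_cases hp : (p.1 : ℤ) = 0 ∧ p.2.1 = []
  · rw [wordCons_of_trivial hp, hp.1, hp.2, wordWeight_cons, wordFrequency_cons, hα0]
    simp [wordFrequency]
  · rw [wordCons_of_not_trivial hp]

/-- The sum of `|⟨v, f_w⟩|²` over the words of the weighted exponential family. -/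
noncomputable def frameSum (R : ℤ) (L : Finset ℤ) (α : ℤ → ℂ) (μ : Measure ℝ) [IsFiniteMeasure μ]
    (v : Lp ℂ 2 μ) : ℝ≥0∞ :=
  ∑' w : Word L, ENNReal.ofReal (‖(inner ℂ v (weightedExpFamily R L α μ w) : ℂ)‖ ^ 2)

/-- The part of `frameSum` that comes from the words of length at most `n`. -/
noncomputable def truncFrameSum (R : ℤ) (L : Finset ℤ) (α : ℤ → ℂ) (μ : Measure ℝ)
    [IsFiniteMeasure μ] (n : ℕ) (v : Lp ℂ 2 μ) : ℝ≥0∞ :=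
  ∑' w : Word L, if w.1.length ≤ n then
    ENNReal.ofReal (‖(inner ℂ v (weightedExpFamily R L α μ w) : ℂ)‖ ^ 2) else 0

lemma frameSum_eq_sum {R : ℤ} (hR : R ≠ 0) {B L : Finset ℤ} (hL : (0 : ℤ) ∈ L) {μ : Measure ℝ}
    [IsFiniteMeasure μ] (h : IsSelfAffineMeasure R B μ) {α : ℤ → ℂ} (hα0 : α 0 = 1)
    (v : Lp ℂ 2 μ) :
    frameSum R L α μ v = ∑ l : L, frameSum R L α μ (letterOp h α l v) := by
  rw [frameSum, ← (Equiv.ofBijective _ (bijective_wordCons hL)).tsum_eq, ENNReal.tsum_prod',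
    tsum_fintype]
  simp only [Equiv.ofBijective_apply, inner_weightedExpFamily_wordCons hR h hα0]
  rfl

lemma truncFrameSum_succ {R : ℤ} (hR : R ≠ 0) {B L : Finset ℤ} (hL : (0 : ℤ) ∈ L)
    {μ : Measure ℝ} [IsFiniteMeasure μ] (h : IsSelfAffineMeasure R B μ) {α : ℤ → ℂ}
    (hα0 : α 0 = 1) (n : ℕ) (v : Lp ℂ 2 μ) :
    truncFrameSum R L α μ (n + 1) v = ∑ l : L, truncFrameSum R L α μ n (letterOp h α l v) := by
  rw [truncFrameSum, ← (Equiv.ofBijective _ (bijective_wordCons hL)).tsum_eq, ENNReal.tsum_prod',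
    tsum_fintype]
  simp only [Equiv.ofBijective_apply, inner_weightedExpFamily_wordCons hR h hα0,
    length_wordCons_le]
  rfl

/-- Induction on the length, for all `v` at once: the bounds for the vectors `letterOp h α l v` add
up to `‖v‖²`. The start is Cauchy–Schwarz against the constant function `1`, the only member of
length `0`. -/
lemma truncFrameSum_le {R : ℤ} (hR : R ≠ 0) {B L : Finset ℤ} (hB : B.Nonempty)
    (hL : (0 : ℤ) ∈ L) {μ : Measure ℝ} [IsProbabilityMeasure μ] (h : IsSelfAffineMeasure R B μ)
    {α : ℤ → ℂ} (hα0 : α 0 = 1)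
    (hT : (weightMatrix R B L α).conjTranspose * weightMatrix R B L α = 1)
    (n : ℕ) (v : Lp ℂ 2 μ) : truncFrameSum R L α μ n v ≤ ENNReal.ofReal (‖v‖ ^ 2) := by
  induction n generalizing v with
  | zero =>
    rw [truncFrameSum, tsum_eq_single (emptyWord L)]
    · rw [if_pos (by simp [emptyWord])]
      refine ENNReal.ofReal_le_ofReal ?_
      gcongr
      refine (norm_inner_le_norm _ _).trans ?_
      simp [weightedExpFamily, emptyWord, wordWeight, norm_expLp]
    · intro w hw
      rw [if_neg]
      intro h0
      exact hw (Subtype.ext (List.length_eq_zero_iff.1 (Nat.le_zero.1 h0)))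
  | succ n ih =>
    rw [truncFrameSum_succ hR hL h hα0, ← sum_norm_sq_letterOp hB h hT,
      ENNReal.ofReal_sum_of_nonneg fun _ _ => by positivity]
    exact Finset.sum_le_sum fun l _ => ih _

/-- The Bessel inequality for the weighted exponential family. -/
lemma frameSum_le {R : ℤ} (hR : R ≠ 0) {B L : Finset ℤ} (hB : B.Nonempty)
    (hL : (0 : ℤ) ∈ L) {μ : Measure ℝ} [IsProbabilityMeasure μ] (h : IsSelfAffineMeasure R B μ)
    {α : ℤ → ℂ} (hα0 : α 0 = 1)
    (hT : (weightMatrix R B L α).conjTranspose * weightMatrix R B L α = 1)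
    (v : Lp ℂ 2 μ) : frameSum R L α μ v ≤ ENNReal.ofReal (‖v‖ ^ 2) := by
  rw [frameSum, ENNReal.tsum_eq_iSup_sum]
  refine iSup_le fun s => ?_
  refine le_trans ?_ (truncFrameSum_le hR hB hL h hα0 hT (s.sup fun w => w.1.length) v)
  refine le_trans ?_ (ENNReal.sum_le_tsum s)
  refine Finset.sum_le_sum fun w hw => ?_
  rw [if_pos (Finset.le_sup (f := fun w : Word L => w.1.length) hw)]

/-! ### Bessel families -/

/-- The analysis operator of a family that satisfies the Bessel inequality with bound `1`. -/
lemma exists_analysisOp {ι H : Type*} [NormedAddCommGroup H] [InnerProductSpace ℂ H] (f : ι → H)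
    (hf : ∀ v, ∑' i, ENNReal.ofReal (‖(inner ℂ v (f i) : ℂ)‖ ^ 2) ≤ ENNReal.ofReal (‖v‖ ^ 2)) :
    ∃ C : H →L[ℂ] lp (fun _ : ι => ℂ) 2, (∀ v, ‖C v‖ ≤ ‖v‖) ∧
      ∀ v, HasSum (fun i => ‖(inner ℂ v (f i) : ℂ)‖ ^ 2) (‖C v‖ ^ 2) := by
  have hsum : ∀ v, Summable fun i => ‖(inner ℂ v (f i) : ℂ)‖ ^ 2 := by
    intro v
    have h1 := ENNReal.summable_toReal ((hf v).trans_lt ENNReal.ofReal_lt_top).ne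
    refine h1.congr fun i => ?_
    rw [ENNReal.toReal_ofReal (by positivity)]
  have hle : ∀ v, ∑' i, ‖(inner ℂ v (f i) : ℂ)‖ ^ 2 ≤ ‖v‖ ^ 2 := by
    intro v
    have h1 := hf v
    rwa [← ENNReal.ofReal_tsum_of_nonneg (fun _ => by positivity) (hsum v),
      ENNReal.ofReal_le_ofReal_iff (by positivity)] at h1
  have hmem : ∀ v, Memℓp (fun i => (inner ℂ (f i) v : ℂ)) 2 := by
    intro v
    refine memℓp_gen ((hsum v).congr fun i => ?_)
    rw [norm_inner_symm]
    simp
  -- The family stands in the first, conjugate-linear slot, so that the map is linear in `v`; the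
  -- moduli are unaffected.
  let C₀ : H →ₗ[ℂ] lp (fun _ : ι => ℂ) 2 :=
    { toFun := fun v => ⟨fun i => inner ℂ (f i) v, hmem v⟩
      map_add' := fun u v => Subtype.ext (funext fun i => inner_add_right _ _ _)
      map_smul' := fun c v => Subtype.ext (funext fun i => inner_smul_right _ _ _) }
  have hnorm : ∀ v, ‖C₀ v‖ ^ 2 = ∑' i, ‖(inner ℂ v (f i) : ℂ)‖ ^ 2 := by
    intro v
    have := lp.norm_rpow_eq_tsum (p := 2) (by norm_num) (C₀ v)
    simp only [ENNReal.toReal_ofNat, Real.rpow_ofNat] at this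
    rw [this]
    exact tsum_congr fun i => by rw [norm_inner_symm]; rfl
  have hC : ∀ v, ‖C₀ v‖ ≤ 1 * ‖v‖ := fun v => by
    rw [one_mul]
    refine (sq_le_sq₀ (norm_nonneg _) (norm_nonneg _)).1 ?_
    rw [hnorm]
    exact hle v
  refine ⟨C₀.mkContinuous 1 hC, fun v => (hC v).trans_eq (one_mul _), fun v => ?_⟩
  have : C₀.mkContinuous 1 hC v = C₀ v := rfl
  rw [this, hnorm]
  exact (hsum v).hasSum

/-- A contraction that preserves the norm of the vectors of a total set of unit vectors is an
isometry. -/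
lemma norm_map_eq_of_total {H K : Type*} [NormedAddCommGroup H] [InnerProductSpace ℂ H]
    [CompleteSpace H] [NormedAddCommGroup K] [InnerProductSpace ℂ K] [CompleteSpace K]
    (C : H →L[ℂ] K) (hC : ∀ v, ‖C v‖ ≤ ‖v‖) (s : Set H)
    (hs : ∀ v : H, (∀ u ∈ s, (inner ℂ v u : ℂ) = 0) → v = 0)
    (hs' : ∀ u ∈ s, ‖C u‖ = ‖u‖) (v : H) : ‖C v‖ = ‖v‖ := by
  set D := C.adjoint with hD
  -- `‖C*C u‖ ≤ ‖u‖` together with `Re ⟨C*C u, u⟩ = ‖u‖²` leaves `‖C*C u - u‖² ≤ 0`.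
  have hfix : ∀ u ∈ s, D (C u) = u := by
    intro u hu
    have h1 : ‖D (C u)‖ ≤ ‖u‖ := by
      have h2 : ‖D (C u)‖ * ‖D (C u)‖ ≤ ‖D (C u)‖ * ‖C u‖ := by
        rw [← inner_self_eq_norm_mul_norm (𝕜 := ℂ), hD, ContinuousLinearMap.adjoint_inner_left]
        refine (re_inner_le_norm _ _).trans ?_
        rw [mul_comm]
        gcongr
        exact hC _
      rw [← hs' u hu]
      by_contra! h3
      have : 0 < ‖D (C u)‖ := (norm_nonneg _).trans_lt h3
      nlinarith
    have h2 : RCLike.re (inner ℂ (D (C u)) u : ℂ) = ‖u‖ ^ 2 := by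
      rw [hD, ContinuousLinearMap.adjoint_inner_left, inner_self_eq_norm_sq, hs' u hu]
    have h3 : ‖D (C u) - u‖ ^ 2 ≤ 0 := by
      rw [norm_sub_sq (𝕜 := ℂ), h2]
      nlinarith [norm_nonneg (D (C u)), norm_nonneg u]
    exact sub_eq_zero.1 (norm_eq_zero.1 (pow_eq_zero_iff two_ne_zero |>.1
      (le_antisymm h3 (by positivity))))
  -- Since `C*C` is self-adjoint and fixes `s`, the vector `C*C v - v` is orthogonal to `s`.
  have hall : D (C v) = v := by
    refine sub_eq_zero.1 (hs _ fun u hu => ?_)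
    rw [inner_sub_left, hD, ContinuousLinearMap.adjoint_inner_left,
      ← ContinuousLinearMap.adjoint_inner_right, ← hD, hfix u hu, sub_self]
  have h1 : ‖C v‖ ^ 2 = ‖v‖ ^ 2 := by
    rw [← inner_self_eq_norm_sq (𝕜 := ℂ) (C v), ← ContinuousLinearMap.adjoint_inner_left, ← hD,
      hall, inner_self_eq_norm_sq]
  exact (sq_eq_sq₀ (norm_nonneg _) (norm_nonneg _)).1 h1

/-! ### Exponentials as an analytic curve -/

/-- The function `2πi x` is unbounded, but clamping `x` to `[-C, C]` changes it only on a null set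
and puts it in the Banach algebra of bounded continuous functions, where `t ↦ exp (t g)` is
analytic. -/
lemma exists_expLp_eq_toLp_exp {μ : Measure ℝ} [IsFiniteMeasure μ] {C : ℝ} (hC : 0 ≤ C)
    (hμ : ∀ᵐ x ∂μ, |x| ≤ C) : ∃ g : ℝ →ᵇ ℂ, ∀ t : ℝ,
      expLp μ t = BoundedContinuousFunction.toLp 2 μ ℂ (NormedSpace.exp (t • g)) := by
  have hcont : Continuous fun x : ℝ => (2 * Real.pi * Complex.I) * ((max (-C) (min x C) : ℝ) : ℂ) := by
    fun_prop
  have hbound : ∀ x : ℝ,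
      ‖(2 * Real.pi * Complex.I) * ((max (-C) (min x C) : ℝ) : ℂ)‖ ≤ 2 * Real.pi * C := by
    intro x
    have h1 : |max (-C) (min x C)| ≤ C :=
      abs_le.2 ⟨le_max_left _ _, max_le (by linarith) (min_le_right _ _)⟩
    rw [norm_mul, norm_mul, norm_mul, Complex.norm_I, Complex.norm_real, Complex.norm_real,
      Real.norm_eq_abs, Real.norm_eq_abs, abs_of_pos Real.pi_pos]
    simp only [Complex.norm_ofNat, mul_one]
    gcongr
  let g : ℝ →ᵇ ℂ := BoundedContinuousFunction.ofNormedAddCommGroup _ hcont _ hbound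
  refine ⟨g, fun t => ?_⟩
  refine Lp.ext ?_
  have h1 : expLp μ t =ᵐ[μ] _ := (memLp_expFun μ t).coeFn_toLp
  have h2 := BoundedContinuousFunction.coeFn_toLp (p := 2) (μ := μ) ℂ (NormedSpace.exp (t • g))
  filter_upwards [h1, h2, hμ] with x h1 h2 hx
  rw [h1, h2]
  have h3 : (NormedSpace.exp (t • g)) x = NormedSpace.exp ((t • g) x) := by
    let ev : (ℝ →ᵇ ℂ) →+* ℂ :=
      { toFun := fun f => f x
        map_one' := rfl
        map_mul' := fun _ _ => rfl
        map_zero' := rfl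
        map_add' := fun _ _ => rfl }
    exact NormedSpace.map_exp ev (continuous_eval_const x) (t • g)
  rw [h3, ← Complex.exp_eq_exp_ℂ, expFun]
  congr 1
  have h4 : max (-C) (min x C) = x := by
    rw [min_eq_left (abs_le.1 hx).2, max_eq_right (abs_le.1 hx).1]
  have h5 : (t • g) x = t • ((2 * Real.pi * Complex.I) * ((max (-C) (min x C) : ℝ) : ℂ)) := rfl
  rw [h5, h4, Complex.real_smul]
  ring

/-- The order `⊤` in `WithTop ℕ∞` is `ω`, so this is analyticity and not merely smoothness. -/
lemma contDiff_omega_expLp {μ : Measure ℝ} [IsFiniteMeasure μ] {C : ℝ} (hC : 0 ≤ C)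
    (hμ : ∀ᵐ x ∂μ, |x| ≤ C) : ContDiff ℝ (⊤ : WithTop ℕ∞) (expLp μ) := by
  obtain ⟨g, hg⟩ := exists_expLp_eq_toLp_exp hC hμ
  have h1 : ContDiff ℝ (⊤ : WithTop ℕ∞) (NormedSpace.exp : (ℝ →ᵇ ℂ) → (ℝ →ᵇ ℂ)) :=
    contDiff_iff_contDiffAt.2 fun x => (NormedSpace.exp_analytic (𝕂 := ℝ) x).contDiffAt
  have h2 : ContDiff ℝ (⊤ : WithTop ℕ∞) fun t : ℝ => NormedSpace.exp (t • g) :=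
    h1.comp (contDiff_id.smul contDiff_const)
  have h3 := ((BoundedContinuousFunction.toLp (E := ℂ) 2 μ ℂ).restrictScalars ℝ).contDiff.comp h2
  rw [funext hg]
  exact h3

lemma analyticOnNhd_norm_sq_expLp {μ : Measure ℝ} [IsFiniteMeasure μ] {C : ℝ} (hC : 0 ≤ C)
    (hμ : ∀ᵐ x ∂μ, |x| ≤ C) {ι : Type*} (T : Lp ℂ 2 μ →L[ℂ] lp (fun _ : ι => ℂ) 2) :
    AnalyticOnNhd ℝ (fun t => ‖T (expLp μ t)‖ ^ 2) Set.univ := by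
  refine contDiff_omega_iff_analyticOnNhd.1 ?_
  refine ContDiff.norm_sq ℂ ?_
  exact (T.restrictScalars ℝ).contDiff.comp (contDiff_omega_expLp hC hμ)

/-! ### Exponentials are total -/

/-- The positive and negative parts of `f` are densities of finite measures with the same
characteristic function, hence agree almost everywhere; at each point one of them vanishes. -/
lemma ae_eq_zero_of_integral_expFun_mul_real {μ : Measure ℝ} [IsFiniteMeasure μ] {f : ℝ → ℝ}
    (hf : Integrable f μ) (h : ∀ t : ℝ, ∫ x, expFun t x * (f x : ℂ) ∂μ = 0) : f =ᵐ[μ] 0 := by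
  set p : ℝ → ℝ≥0∞ := fun x => ENNReal.ofReal (f x) with hp
  set q : ℝ → ℝ≥0∞ := fun x => ENNReal.ofReal (-f x) with hq
  have hpm : AEMeasurable p μ := hf.1.aemeasurable.ennreal_ofReal
  have hqm : AEMeasurable q μ := hf.neg.1.aemeasurable.ennreal_ofReal
  have hpf : ∫⁻ x, p x ∂μ ≠ ⊤ := hf.lintegral_lt_top.ne
  have hqf : ∫⁻ x, q x ∂μ ≠ ⊤ := hf.neg.lintegral_lt_top.ne
  have := isFiniteMeasure_withDensity hpf
  have := isFiniteMeasure_withDensity hqf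
  have hchar : ∀ (r : ℝ → ℝ≥0∞), AEMeasurable r μ → (∀ x, r x < ⊤) → ∀ t : ℝ,
      charFun (μ.withDensity r) t = ∫ x, expFun (t / (2 * Real.pi)) x * ((r x).toReal : ℂ) ∂μ := by
    intro r hr hr' t
    rw [charFun_apply_real, integral_withDensity_eq_integral_toReal_smul₀ hr (ae_of_all _ hr')]
    congr 1
    ext x
    rw [expFun_eq, Complex.real_smul, mul_comm]
    congr 3
    have := Real.pi_ne_zero
    push_cast
    field_simp
  have hint : ∀ {r : ℝ → ℝ≥0∞}, Integrable (fun x => (r x).toReal) μ → ∀ t : ℝ,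
      Integrable (fun x => expFun t x * ((r x).toReal : ℂ)) μ := by
    intro r hr t
    exact (memLp_expFun_mul t (memLp_one_iff_integrable.2 hr.ofReal)).integrable le_rfl
  have heq : μ.withDensity p = μ.withDensity q := by
    refine Measure.ext_of_charFun (funext fun t => ?_)
    rw [hchar p hpm (fun _ => ENNReal.ofReal_lt_top), hchar q hqm (fun _ => ENNReal.ofReal_lt_top),
      ← sub_eq_zero, ← integral_sub (hint (integrable_toReal_of_lintegral_ne_top hpm hpf) _)
        (hint (integrable_toReal_of_lintegral_ne_top hqm hqf) _), ← h (t / (2 * Real.pi))]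
    congr 1
    ext x
    rw [← mul_sub, ← Complex.ofReal_sub]
    congr 2
    simp only [hp, hq, ENNReal.toReal_ofReal']
    rcases le_total 0 (f x) with hx | hx
    · rw [max_eq_left hx, max_eq_right (by linarith), sub_zero]
    · rw [max_eq_right hx, max_eq_left (by linarith), zero_sub, neg_neg]
  have hae := (withDensity_eq_iff hpm hqm hpf).1 heq
  filter_upwards [hae] with x hx
  simp only [hp, hq] at hx
  rcases le_total 0 (f x) with h0 | h0
  · rw [ENNReal.ofReal_of_nonpos (neg_nonpos.2 h0), ENNReal.ofReal_eq_zero] at hx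
    exact le_antisymm hx h0
  · rw [ENNReal.ofReal_of_nonpos h0, eq_comm, ENNReal.ofReal_eq_zero] at hx
    exact le_antisymm h0 (by simpa using hx)

/-- The exponentials are total in `L²` of a finite measure on the line. -/
lemma eq_zero_of_inner_expLp {μ : Measure ℝ} [IsFiniteMeasure μ] {v : Lp ℂ 2 μ}
    (h : ∀ t : ℝ, (inner ℂ v (expLp μ t) : ℂ) = 0) : v = 0 := by
  have h1 : ∀ t : ℝ, ∫ x, expFun t x * conj (v x) ∂μ = 0 := fun t => by
    rw [← inner_expLp_right, h]
  -- Conjugating the relation at `-t` replaces `conj v` by `v`; sums and differences then isolate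
  -- the real and imaginary parts.
  have h2 : ∀ t : ℝ, ∫ x, expFun t x * v x ∂μ = 0 := by
    intro t
    have h3 := congrArg conj (h1 (-t))
    rw [← integral_conj, map_zero] at h3
    simpa only [map_mul, conj_expFun, neg_neg, Complex.conj_conj] using h3
  have hv : MemLp v 2 μ := Lp.memLp v
  have hi1 : ∀ t, Integrable (fun x => expFun t x * v x) μ := fun t =>
    (memLp_expFun_mul t hv).integrable (by norm_num)
  have hi2 : ∀ t, Integrable (fun x => expFun t x * conj (v x)) μ := fun t =>
    (memLp_expFun_mul t hv.star).integrable (by norm_num)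
  have hvi : Integrable v μ := hv.integrable (by norm_num)
  have hre := ae_eq_zero_of_integral_expFun_mul_real hvi.re fun t => by
    have h3 : ∫ x, (expFun t x * v x + expFun t x * conj (v x)) ∂μ = 0 := by
      rw [integral_add (hi1 t) (hi2 t), h1, h2, add_zero]
    have h4 : ∀ x, expFun t x * v x + expFun t x * conj (v x)
        = 2 * (expFun t x * ((RCLike.re (v x) : ℝ) : ℂ)) := fun x => by
      rw [← mul_add, Complex.add_conj]
      simp only [RCLike.re_eq_complex_re]
      push_cast
      ring
    simp only [h4] at h3
    rw [integral_const_mul] at h3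
    simpa using h3
  have him := ae_eq_zero_of_integral_expFun_mul_real hvi.im fun t => by
    have h3 : ∫ x, (expFun t x * v x - expFun t x * conj (v x)) ∂μ = 0 := by
      rw [integral_sub (hi1 t) (hi2 t), h1, h2, sub_zero]
    have h4 : ∀ x, expFun t x * v x - expFun t x * conj (v x)
        = (2 * Complex.I) * (expFun t x * ((RCLike.im (v x) : ℝ) : ℂ)) := fun x => by
      rw [← mul_sub, Complex.sub_conj]
      simp only [RCLike.im_eq_complex_im]
      push_cast
      ring
    simp only [h4] at h3
    rw [integral_const_mul] at h3
    simpa using h3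
  refine Lp.ext ?_
  filter_upwards [hre, him, Lp.coeFn_zero ℂ 2 μ] with x h3 h4 h5
  rw [h5]
  exact Complex.ext h3 h4

/-! ### Finite invariant sets -/

/-- The transition `x → R⁻¹ (x - l)`, `l ∈ L`, between points with nonvanishing digit sum at the
target. -/
def Transition (R : ℤ) (B L : Finset ℤ) (x y : ℝ) : Prop :=
  ∃ l ∈ L, y = (x - l) * (R : ℝ)⁻¹ ∧ digitSum B y ≠ 0

/-- Each step reads `x = R y + l`. For a cycle `y = x` this gives `(1 - R^(n+1)) x ∈ ℤ`; the
exponent is positive, so the denominator is prime to `R`. -/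
lemma exists_eq_pow_mul_add_of_transGen {R : ℤ} (hR : R ≠ 0) {B L : Finset ℤ} {x y : ℝ}
    (h : Relation.TransGen (Transition R B L) x y) :
    ∃ n : ℕ, ∃ k : ℤ, x = (R : ℝ) ^ (n + 1) * y + k := by
  have hR' : (R : ℝ) ≠ 0 := by exact_mod_cast hR
  have hone : ∀ {a b : ℝ}, Transition R B L a b → ∃ l : ℤ, a = R * b + l := by
    rintro a b ⟨l, _, rfl, _⟩
    exact ⟨l, by field_simp; ring⟩
  induction h with
  | single h =>
    obtain ⟨l, hl⟩ := hone h
    exact ⟨0, l, by simpa using hl⟩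
  | tail _ h ih =>
    obtain ⟨n, k, hk⟩ := ih
    obtain ⟨l, hl⟩ := hone h
    refine ⟨n + 1, R ^ (n + 1) * l + k, ?_⟩
    rw [hk, hl]
    push_cast
    ring

lemma digitSum_eq_of_mem_congClass {R : ℤ} {B : Finset ℤ} {l l' : ℤ}
    (h : l' ∈ congClass R B l) (x : ℝ) :
    digitSum B ((x - l') * (R : ℝ)⁻¹) = digitSum B ((x - l) * (R : ℝ)⁻¹) := by
  rw [digitSum, digitSum]
  congr 1
  refine Finset.sum_congr rfl fun b _ => ?_
  obtain ⟨n, hn⟩ := h b b.2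
  have h1 : (x - l) * (R : ℝ)⁻¹ = (x - l') * (R : ℝ)⁻¹ + ((l' - l : ℤ) : ℝ) * (R : ℝ)⁻¹ := by
    push_cast
    ring
  rw [h1, expFun_add, expFun_eq_one (t := ((l' - l : ℤ) : ℝ) * (R : ℝ)⁻¹) n (by
    rw [← hn]; ring), mul_one]

/-- Congruence mod `R` always implies membership in the class, so the two sets can differ only by an
element of the class that is not congruent to `l`. -/
lemma exists_mem_congClass_not_modEq {R : ℤ} (hR : R ≠ 0) {B L : Finset ℤ} {l : ℤ}
    (h : congClass R B l ∩ (L : Set ℤ) ≠ {l' : ℤ | l' ∈ L ∧ l' ≡ l [ZMOD R]}) :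
    ∃ l' ∈ L, l' ∈ congClass R B l ∧ ¬R ∣ l' - l := by
  by_contra! hcon
  refine h (Set.ext fun l' => ⟨fun ⟨h1, h2⟩ => ⟨h2, ?_⟩, fun ⟨h1, h2⟩ => ⟨fun b _ => ?_, h1⟩⟩)
  · exact (Int.modEq_iff_dvd.2 (hcon l' h2 h1)).symm
  · obtain ⟨k, hk⟩ := Int.modEq_iff_dvd.1 h2.symm
    refine ⟨k * b, ?_⟩
    have hR' : (R : ℝ) ≠ 0 := by exact_mod_cast hR
    rw [hk]
    push_cast
    field_simp

/-- A nonempty finite set that is invariant under the transitions contains `0`. -/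
lemma zero_mem_of_finite_invariant {R : ℤ} (hR : 2 ≤ |R|) {B L : Finset ℤ}
    (hclass : ∀ l ∈ L, l ≠ 0 →
      congClass R B l ∩ (L : Set ℤ) ≠ {l' : ℤ | l' ∈ L ∧ l' ≡ l [ZMOD R]})
    {M : Set ℝ} (hfin : M.Finite) (hne : M.Nonempty) (hex : ∀ x ∈ M, ∃ y, Transition R B L x y)
    (hinv : ∀ x ∈ M, ∀ y, Transition R B L x y → y ∈ M) : (0 : ℝ) ∈ M := by
  have hR0 : R ≠ 0 := by
    rintro rfl
    simp at hR
  have hR' : (R : ℝ) ≠ 0 := by exact_mod_cast hR0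
  set F : Set (Set ℝ) :=
    {S | S ⊆ M ∧ S.Nonempty ∧ ∀ x ∈ S, ∀ y, Transition R B L x y → y ∈ S} with hF
  have hFfin : F.Finite := hfin.finite_subsets.subset fun S hS => hS.1
  obtain ⟨S, hS⟩ := hFfin.exists_minimal ⟨M, subset_rfl, hne, hinv⟩
  obtain ⟨hSM, hSne, hSinv⟩ := hS.prop
  -- The points reachable from `x` form a nonempty invariant subset of `S`, which by minimality is
  -- all of `S` and so contains `x`.
  have hcyc : ∀ x ∈ S, Relation.TransGen (Transition R B L) x x := by
    intro x hx
    have hP : {y | Relation.TransGen (Transition R B L) x y} ⊆ S := by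
      intro y hy
      induction hy with
      | single h => exact hSinv x hx _ h
      | tail _ h ih => exact hSinv _ ih _ h
    obtain ⟨y, hy⟩ := hex x (hSM hx)
    exact hS.le_of_le ⟨hP.trans hSM, ⟨y, .single hy⟩, fun z hz w hw => hz.tail hw⟩ hP hx
  have hden : ∀ x ∈ S, ∃ d k : ℤ, IsCoprime R d ∧ (d : ℝ) * x = k := by
    intro x hx
    obtain ⟨n, k, hk⟩ := exists_eq_pow_mul_add_of_transGen hR0 (hcyc x hx)
    refine ⟨1 - R ^ (n + 1), k, ⟨R ^ n, 1, by ring⟩, ?_⟩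
    push_cast
    linarith
  have hdiv : ∀ x ∈ S, x * (R : ℝ)⁻¹ ∈ S := by
    intro x hx
    obtain ⟨y, hy⟩ := hex x (hSM hx)
    have hyS := hSinv x hx y hy
    obtain ⟨l, hl, hyl, hy0⟩ := hy
    by_cases hl0 : l = 0
    · subst hl0
      rw [hyl] at hyS
      simpa using hyS
    exfalso
    obtain ⟨l', hl', hmem, hndvd⟩ := exists_mem_congClass_not_modEq hR0 (hclass l hl hl0)
    -- Letters of one class share the digit sum at their targets, so the step by `l'` is allowed as
    -- well.
    have hy'S : (x - l') * (R : ℝ)⁻¹ ∈ S :=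
      hSinv x hx _ ⟨l', hl', rfl, by rwa [digitSum_eq_of_mem_congClass hmem, ← hyl]⟩
    obtain ⟨d, k, hd, hk⟩ := hden _ hyS
    obtain ⟨d', k', hd', hk'⟩ := hden _ hy'S
    -- With `y' = (x - l')/R`, `d y = k` and `d' y' = k'`, multiplying `l' - l = R (y - y')` by `d
    -- d'` gives `R (k d' - k' d)`, and `R` is prime to `d d'`.
    refine hndvd ((hd.mul_right hd').dvd_of_dvd_mul_left ⟨k * d' - k' * d, ?_⟩)
    have h1 : ((l' - l : ℤ) : ℝ) = R * (y - (x - l') * (R : ℝ)⁻¹) := by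
      rw [hyl]
      push_cast
      field_simp
      ring
    have h2 : (((d * d') * (l' - l) : ℤ) : ℝ) = ((R * (k * d' - k' * d) : ℤ) : ℝ) := by
      rw [Int.cast_mul, h1]
      push_cast
      rw [← hk, ← hk']
      ring
    exact_mod_cast h2
  obtain ⟨x, hx⟩ := hSne
  have hpow : ∀ n : ℕ, x * ((R : ℝ)⁻¹) ^ n ∈ S := by
    intro n
    induction n with
    | zero => simpa using hx
    | succ n ih =>
      rw [pow_succ, ← mul_assoc]
      exact hdiv _ ih
  have hlim : Tendsto (fun n : ℕ => x * ((R : ℝ)⁻¹) ^ n) atTop (𝓝 0) := by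
    simpa using (tendsto_pow_atTop_nhds_zero_of_abs_lt_one (abs_inv_lt_one hR)).const_mul x
  exact hSM ((hfin.subset hSM).isClosed.mem_of_tendsto hlim (Eventually.of_forall hpow))

/-! ### Parseval frames -/

/-- An average of numbers that are at least `c` equals `c` only if every term with nonzero weight
equals `c`. -/
lemma eq_of_sum_mul_eq {ι : Type*} {s : Finset ι} {p a : ι → ℝ} {c : ℝ} (hp : ∀ i ∈ s, 0 ≤ p i)
    (hp1 : ∑ i ∈ s, p i = 1) (ha : ∀ i ∈ s, c ≤ a i) (h : ∑ i ∈ s, p i * a i = c) {i : ι}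
    (hi : i ∈ s) (hpi : p i ≠ 0) : a i = c := by
  have h0 : ∑ i ∈ s, p i * (a i - c) = 0 := by
    simp only [mul_sub, Finset.sum_sub_distrib, ← Finset.sum_mul, h, hp1, one_mul, sub_self]
  have := (Finset.sum_eq_zero_iff_of_nonneg fun j hj =>
    mul_nonneg (hp j hj) (sub_nonneg.2 (ha j hj))).1 h0 i hi
  exact sub_eq_zero.1 ((mul_eq_zero.1 this).resolve_left hpi)

/-- An analytic function bounded by `1`, equal to `1` at `0`, that is averaged by the transitions
is constant. -/
lemma eq_one_of_harmonic {R : ℤ} (hR : 2 ≤ |R|) {B L : Finset ℤ} (hL : (0 : ℤ) ∈ L)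
    (hclass : ∀ l ∈ L, l ≠ 0 →
      congClass R B l ∩ (L : Set ℤ) ≠ {l' : ℤ | l' ∈ L ∧ l' ≡ l [ZMOD R]})
    {H : ℝ → ℝ} (hHan : AnalyticOnNhd ℝ H Set.univ) (hHle : ∀ t, H t ≤ 1) (hH0 : H 0 = 1)
    {p : ℝ → L → ℝ} (hp : ∀ t l, 0 ≤ p t l)
    (hp0 : ∀ t l, p t l = 0 ↔ digitSum B ((t - (l : ℤ)) * (R : ℝ)⁻¹) = 0)
    (hpsum : ∀ t, ∑ l, p t l = 1)
    (hHrec : ∀ t, ∑ l, p t l * H ((t - (l : ℤ)) * (R : ℝ)⁻¹) = H t) (t : ℝ) : H t = 1 := by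
  have hR2 : (2 : ℝ) ≤ |(R : ℝ)| := by exact_mod_cast hR
  by_contra hne
  obtain ⟨Λ, hΛ⟩ := exists_digit_bound L
  -- The interval `[-D, D]` contains `t` and is preserved by every `x ↦ (x - l)/R`, since `(D +
  -- Λ)/|R| ≤ 2D/2 = D`.
  set D : ℝ := max |t| Λ with hD
  have hΛ0 : 0 ≤ Λ := (abs_nonneg _).trans (hΛ 0 hL)
  have htD : t ∈ Set.Icc (-D) D := abs_le.1 (le_max_left _ _)
  obtain ⟨x₀, hx₀, hmin⟩ := isCompact_Icc.exists_isMinOn ⟨t, htD⟩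
    (hHan.continuousOn.mono (Set.subset_univ (Set.Icc (-D) D)))
  have hmin' : ∀ x ∈ Set.Icc (-D) D, H x₀ ≤ H x := fun x hx => hmin hx
  have hlt : H x₀ < 1 := (hmin' t htD).trans_lt (lt_of_le_of_ne (hHle t) hne)
  have hIcc : ∀ x ∈ Set.Icc (-D) D, ∀ l : L, (x - (l : ℤ)) * (R : ℝ)⁻¹ ∈ Set.Icc (-D) D := by
    intro x hx l
    rw [Set.mem_Icc, ← abs_le, abs_mul, abs_inv, ← div_eq_mul_inv, div_le_iff₀ (by linarith)]
    have h1 : |x - (l : ℤ)| ≤ |x| + |((l : ℤ) : ℝ)| := abs_sub _ _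
    have h2 : |((l : ℤ) : ℝ)| ≤ D := (hΛ l l.2).trans (le_max_right _ _)
    have h3 : |x| ≤ D := abs_le.2 hx
    nlinarith [(abs_nonneg x).trans h3]
  set M : Set ℝ := {x | x ∈ Set.Icc (-D) D ∧ H x = H x₀} with hM
  -- Infinitely many minimizers would accumulate in the interval, and the identity theorem would
  -- make `H` constant, against `H 0 = 1`.
  have hfin : M.Finite := by
    by_contra hinf
    obtain ⟨z, _, hz⟩ := Set.Infinite.exists_accPt_of_subset_isCompact hinf
      isCompact_Icc fun x hx => hx.1
    have hfreq : ∃ᶠ x in 𝓝[≠] z, H x = (fun _ => H x₀) x :=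
      (accPt_iff_frequently_nhdsNE.1 hz).mono fun x hx => hx.2
    have := congrFun (hHan.eq_of_frequently_eq analyticOnNhd_const hfreq) 0
    rw [hH0] at this
    exact hlt.ne this.symm
  have h0 : (0 : ℝ) ∈ M := by
    refine zero_mem_of_finite_invariant (B := B) (L := L) hR hclass hfin ⟨x₀, hx₀, rfl⟩ ?_ ?_
    · intro x _
      obtain ⟨l, _, hl⟩ := Finset.exists_ne_zero_of_sum_ne_zero
        ((hpsum x).trans_ne one_ne_zero)
      exact ⟨_, l, l.2, rfl, fun h1 => hl ((hp0 x l).2 h1)⟩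
    · rintro x ⟨hx, hHx⟩ y ⟨l, hl, rfl, hy⟩
      refine ⟨hIcc x hx ⟨l, hl⟩, ?_⟩
      refine eq_of_sum_mul_eq (s := Finset.univ) (p := p x)
        (a := fun l : L => H ((x - (l : ℤ)) * (R : ℝ)⁻¹)) (fun l _ => hp x l) (hpsum x)
        (fun l _ => hmin' _ (hIcc x hx l)) ((hHrec x).trans hHx) (Finset.mem_univ ⟨l, hl⟩) ?_
      exact fun h1 => hy ((hp0 x ⟨l, hl⟩).1 h1)
  exact hlt.ne (h0.2.symm.trans hH0)

/-- The weighted exponential family is a Parseval frame; no overlap is not needed because the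
matrix of the weights has orthonormal columns. -/
theorem isParsevalFrame_weightedExpFamily {R : ℤ} (hR : 2 ≤ |R|) {B L : Finset ℤ}
    (hB : B.Nonempty) (hL : (0 : ℤ) ∈ L) {μ : Measure ℝ} [IsProbabilityMeasure μ]
    (h : IsSelfAffineMeasure R B μ) {α : ℤ → ℂ} (hα : ∀ l ∈ L, α l ≠ 0) (hα0 : α 0 = 1)
    (hT : (weightMatrix R B L α).conjTranspose * weightMatrix R B L α = 1)
    (hclass : ∀ l ∈ L, l ≠ 0 →
      congClass R B l ∩ (L : Set ℤ) ≠ {l' : ℤ | l' ∈ L ∧ l' ≡ l [ZMOD R]}) :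
    IsParsevalFrame (weightedExpFamily R L α μ) := by
  have hR0 : R ≠ 0 := by
    rintro rfl
    simp at hR
  obtain ⟨T, hTle, hTsum⟩ := exists_analysisOp (weightedExpFamily R L α μ)
    (frameSum_le hR0 hB hL h hα0 hT)
  obtain ⟨C, hC, hμC⟩ := h.exists_ae_abs_le hR
  have hframe : ∀ v, frameSum R L α μ v = ENNReal.ofReal (‖T v‖ ^ 2) := fun v => by
    rw [frameSum, ← ENNReal.ofReal_tsum_of_nonneg (fun _ => by positivity) (hTsum v).summable,
      (hTsum v).tsum_eq]
  have hTrec : ∀ v, ‖T v‖ ^ 2 = ∑ l : L, ‖T (letterOp h α l v)‖ ^ 2 := by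
    intro v
    have h1 := frameSum_eq_sum hR0 hL h hα0 v
    simp only [hframe] at h1
    rwa [← ENNReal.ofReal_sum_of_nonneg fun _ _ => by positivity,
      ENNReal.ofReal_eq_ofReal_iff (by positivity) (by positivity)] at h1
  set H : ℝ → ℝ := fun t => ‖T (expLp μ t)‖ ^ 2 with hH
  set p : ℝ → L → ℝ := fun t l => ‖conj (α l) * digitSum B ((t - (l : ℤ)) * (R : ℝ)⁻¹)‖ ^ 2 with hp
  have hHan : AnalyticOnNhd ℝ H Set.univ := analyticOnNhd_norm_sq_expLp hC hμC T
  have hHle : ∀ t, H t ≤ 1 := fun t =>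
    pow_le_one₀ (norm_nonneg _) ((hTle _).trans_eq (norm_expLp μ t))
  -- The empty word alone contributes `|⟨e_0, e_0⟩|² = 1`.
  have hH0 : H 0 = 1 := by
    refine le_antisymm (hHle 0) ?_
    have h1 := le_hasSum (hTsum (expLp μ 0)) (emptyWord L) fun _ _ => by positivity
    refine le_trans (le_of_eq ?_) h1
    have h2 : weightedExpFamily R L α μ (emptyWord L) = expLp μ 0 := by
      have h3 : wordFrequency R (emptyWord L).1 = 0 := wordFrequency_nil R
      rw [weightedExpFamily, h3]
      simp [emptyWord, wordWeight]
    rw [h2, inner_self_eq_norm_sq_to_K, norm_expLp]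
    simp
  have hHrec : ∀ t, ∑ l : L, p t l * H ((t - (l : ℤ)) * (R : ℝ)⁻¹) = H t := by
    intro t
    simp only [hH, hTrec (expLp μ t), letterOp_expLp, map_smul, norm_smul, mul_pow]
    rfl
  have hpsum : ∀ t, ∑ l : L, p t l = 1 := by
    intro t
    have h1 := sum_norm_sq_letterOp hB h hT (expLp μ t)
    simpa only [letterOp_expLp, norm_smul, norm_expLp, mul_one, one_pow] using h1
  have hone : ∀ t, H t = 1 := by
    refine eq_one_of_harmonic hR hL hclass hHan hHle hH0 (p := p) (fun _ _ => by positivity)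
      (fun t l => ?_) hpsum hHrec
    have := hα l l.2
    simp [hp, this]
  intro v
  have hiso := norm_map_eq_of_total T hTle (Set.range (expLp μ))
    (fun v hv => eq_zero_of_inner_expLp fun t => hv _ ⟨t, rfl⟩) (by
      rintro _ ⟨t, rfl⟩
      rw [norm_expLp, ← pow_left_inj₀ (norm_nonneg _) zero_le_one two_ne_zero, one_pow]
      exact hone t) v
  rw [← hiso]
  exact hTsum v

end WeightedFourier

theorem theorem5p3 (R : ℤ) (hR : 2 ≤ |R|) (B : Finset ℤ) (hB : (0 : ℤ) ∈ B)
    (hoverlap : WeightedFourier.NoOverlap R B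
      (WeightedFourier.selfAffineMeasure R B hR (Finset.nonempty_def.2 ⟨0, hB⟩)))
    (L : Finset ℤ) (hL : (0 : ℤ) ∈ L) (α : ℤ → ℂ) (hα : ∀ l ∈ L, α l ≠ 0)
    (hα0 : α 0 = 1)
    (hT : (WeightedFourier.weightMatrix R B L α).conjTranspose *
      WeightedFourier.weightMatrix R B L α = 1)
    (hclass : ∀ l ∈ L, l ≠ 0 →
      WeightedFourier.congClass R B l ∩ (L : Set ℤ) ≠ {l' : ℤ | l' ∈ L ∧ l' ≡ l [ZMOD R]}) :
    WeightedFourier.IsParsevalFrame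
      (WeightedFourier.weightedExpFamily R L α
        (WeightedFourier.selfAffineMeasure R B hR (Finset.nonempty_def.2 ⟨0, hB⟩))) :=
  WeightedFourier.isParsevalFrame_weightedExpFamily hR (Finset.nonempty_def.2 ⟨0, hB⟩) hL
    (WeightedFourier.selfAffineMeasure_spec R B hR _) hα hα0 hT hclass
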